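/- Proposition 4.2. Let $R$ be a discrete valuation ring with maximal ideal $\mathfrak m$ and residue field $k=R/\mathfrak m$, and assume that $R$ is not $\mathfrak m$-adically complete. Let $\widehat R$ be the $\mathfrak m$-adic completion of $R$, let $K=Q(R)$ and $\widetilde K=Q(\widehat R)$ be the quotient fields of $R$ and $\widehat R$, and let $E=E_R(k)$ be an injective hull of $k$ over $R$. Assume that $[\widetilde K:K]=\infty$. Then $E$ carries an $\widehat R$-module structure compatible with its $R$-module structure, and with this structure it is an injective hull $E_{\widehat R}(k)$ of $k$ over $\widehat R$, where $k$ is identified with the residue field of $\widehat R$. Moreover, there are an uncountable cardinal $C$ and $\widehat R$-module isomorphisms $$\operatorname{Ext}^i_R(\widehat R,R)\cong\begin{cases}0 & \text{if } i\neq 1,\\ E\oplus\widetilde K^{(C)} & \text{if } i=1,\end{cases}$$ where $\operatorname{Ext}^i_R(\widehat R,R)$ is an $\widehat R$-module through its first argument and $\widetilde K^{(C)}$ is the direct sum of copies of $\widetilde K$ indexed by $C$. -/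

import Mathlib

universe u v w

open CategoryTheory IsLocalRing

/-- `E` is an injective hull of the `A`-module `M`: it is an injective `A`-module into which `M`
embeds as an essential submodule (every submodule of `E` meeting `M` trivially is zero). -/
structure IsInjectiveHull (A : Type u) [CommRing A] (M : Type u) [AddCommGroup M] [Module A M]
    (E : Type u) [AddCommGroup E] [Module A E] : Prop where
  injective : Module.Injective A E
  exists_essential : ∃ f : M →ₗ[A] E, Function.Injective f ∧
    ∀ N : Submodule A E, N ⊓ LinearMap.range f = ⊥ → N = ⊥

/-- For an `R`-algebra `S` and an `R`-module `M`, the group `Ext^i_R(S, M)`. It is given its own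
name because it carries the `S`-module structure coming from the first variable. -/
def ExtOver (R : Type u) [CommRing R] (S : Type u) [CommRing S] [Algebra R S]
    (M : Type u) [AddCommGroup M] [Module R M] (i : ℕ) : Type u :=
  Abelian.Ext.{u} (ModuleCat.of R S) (ModuleCat.of R M) i

namespace ExtOver

variable (R : Type u) [CommRing R] (S : Type u) [CommRing S] [Algebra R S]
  (M : Type u) [AddCommGroup M] [Module R M] (i : ℕ)

noncomputable instance : AddCommGroup (ExtOver R S M i) :=
  inferInstanceAs (AddCommGroup (Abelian.Ext.{u} (ModuleCat.of R S) (ModuleCat.of R M) i))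

/-- Multiplication by `s` on `S`, as a morphism of `R`-modules. -/
noncomputable def mulHom (s : S) : ModuleCat.of R S ⟶ ModuleCat.of R S :=
  ModuleCat.ofHom (LinearMap.mulLeft R s)

/-- `s : S` acts on `Ext^i_R(S, M)` as the map induced, by functoriality in the first variable,
by multiplication by `s` on `S`. -/
noncomputable instance : SMul S (ExtOver R S M i) where
  smul s e := (Abelian.Ext.mk₀ (mulHom R S s)).comp e (zero_add i)

theorem smul_def (s : S) (e : ExtOver R S M i) :
    s • e = (Abelian.Ext.mk₀ (mulHom R S s)).comp e (zero_add i) := rfl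

theorem mulHom_one : mulHom R S 1 = 𝟙 _ := by
  ext; simp [mulHom]

theorem mulHom_zero : mulHom R S 0 = 0 := by
  ext; simp [mulHom]

theorem mulHom_mul (s t : S) : mulHom R S (s * t) = mulHom R S s ≫ mulHom R S t := by
  ext x; simp [mulHom, mul_left_comm]

theorem mulHom_add (s t : S) : mulHom R S (s + t) = mulHom R S s + mulHom R S t := by
  ext x; simp [mulHom, add_mul]

noncomputable instance : Module S (ExtOver R S M i) where
  one_smul e :=
    (congrArg (fun f => (Abelian.Ext.mk₀ f).comp e (zero_add i)) (mulHom_one R S)).trans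
      (Abelian.Ext.mk₀_id_comp e)
  mul_smul s t e :=
    (congrArg (fun f => (Abelian.Ext.mk₀ f).comp e (zero_add i)) (mulHom_mul R S s t)).trans
      (Abelian.Ext.mk₀_comp_mk₀_assoc (mulHom R S s) (mulHom R S t) e).symm
  smul_zero s := Abelian.Ext.comp_zero (Abelian.Ext.mk₀ (mulHom R S s)) _ i i (zero_add i)
  smul_add s e₁ e₂ := Abelian.Ext.comp_add (Abelian.Ext.mk₀ (mulHom R S s)) e₁ e₂ (zero_add i)
  add_smul s t e := by
    refine (congrArg (fun f => (Abelian.Ext.mk₀ f).comp e (zero_add i))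
      (mulHom_add R S s t)).trans ?_
    refine (congrArg (fun f => Abelian.Ext.comp f e (zero_add i)) (Abelian.Ext.mk₀_add _ _)).trans ?_
    exact Abelian.Ext.add_comp _ _ e (zero_add i)
  zero_smul e := by
    refine (congrArg (fun f => (Abelian.Ext.mk₀ f).comp e (zero_add i)) (mulHom_zero R S)).trans ?_
    refine (congrArg (fun f => Abelian.Ext.comp f e (zero_add i)) (Abelian.Ext.mk₀_zero _ _)).trans ?_
    exact Abelian.Ext.zero_comp _ _ e i (zero_add i)

end ExtOver

/-!
Let `S` be the completion of `R` and `L` its fraction field. The extension `R → S` is immediate: `S`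
is again a discrete valuation ring, with the same uniformizer `ϖ` and the same residue field. This is
all that is used about `S`. It gives `L = K + S` and `K ∩ S = R`, so `K / R = L / S`, and this module
is an injective hull of the residue field over `R` and over `S` (`IsImmediate.isInjectiveHull`,
`FracQuot.isInjectiveHull`). By uniqueness of injective hulls, `E` is isomorphic to `L / S` over `R`,
and it gets its `S`-structure from there.

By the injective resolution `0 → R → K → L / S → 0`, `Ext^i_R(S, R)` vanishes for `i ≥ 2`, and
`X = Ext^1_R(S, R)` is the cokernel of `Hom_R(S, K) → Hom_R(S, L / S)`. Moreover `Hom_R(S, R) = 0`: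
as `R` is dense in `S`, an `R`-linear map `S → R` is multiplication by a constant, and a nonzero
constant would force `L = K` (`IsImmediate.linearMap_eq_zero`).

Sending `m` to the class of `x ↦ x • m` embeds `L / S` into `X`, and since `L / S` is injective over
`S` this is a direct summand. On the quotient `Q` multiplication by `ϖ` is bijective: `X` is divisible
because `L / S` is injective over `R`, and `Q` is torsion-free because an `R`-linear map `S → L / S`
killed by `ϖ` is `S`-linear (`IsConnecting.bijective_smul_quotient`). Hence `Q` is an `L`-vector space.

For its dimension, fix `t` in `L` outside `K`. Sending `φ` to the class of `x ↦ φ(x) t mod S` embeds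
the `K`-dual of `L` into `Q` (`IsConnecting.dualMap_injective`). By the Erdős–Kaplansky theorem the
`K`-dimension of this dual exceeds `[L : K]`, whereas it would be at most `ℵ₀ · [L : K] = [L : K]` if
`Q` had countable dimension over `L` (`aleph0_lt_rank_of_dual_injective`).
-/

/-! ### Injective modules and injective hulls -/

theorem Module.Injective.of_divisible {A : Type u} [CommRing A] [IsPrincipalIdealRing A]
    {M : Type u} [AddCommGroup M] [Module A M]
    (h : ∀ a : A, a ≠ 0 → ∀ m : M, ∃ m' : M, a • m' = m) : Module.Injective A M := by
  refine Module.Baer.injective fun I g ↦ ?_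
  obtain ⟨a, rfl⟩ := IsPrincipalIdealRing.principal I
  obtain rfl | ha := eq_or_ne a 0
  · refine ⟨0, fun x hx ↦ ?_⟩
    have hx0 : x = 0 := by simpa using hx
    subst hx0
    exact (map_zero g).symm
  · obtain ⟨m, hm⟩ := h a ha (g ⟨a, Submodule.mem_span_singleton_self a⟩)
    refine ⟨LinearMap.toSpanSingleton A M m, fun x hx ↦ ?_⟩
    obtain ⟨b, rfl⟩ := Submodule.mem_span_singleton.mp hx
    rw [LinearMap.toSpanSingleton_apply, smul_assoc, hm, ← map_smul]
    rfl

theorem Module.Injective.of_linearEquiv {A : Type u} [CommRing A] {M N : Type u} [AddCommGroup M]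
    [Module A M] [AddCommGroup N] [Module A N] (e : M ≃ₗ[A] N) (h : Module.Injective A M) :
    Module.Injective A N :=
  ((Module.Baer.of_injective h).of_equiv e).injective

namespace IsInjectiveHull

theorem of_linearEquiv {A : Type u} [CommRing A] {k M N : Type u} [AddCommGroup k] [Module A k]
    [AddCommGroup M] [Module A M] [AddCommGroup N] [Module A N] (e : M ≃ₗ[A] N)
    (h : IsInjectiveHull A k M) : IsInjectiveHull A k N := by
  obtain ⟨f, hf, hess⟩ := h.exists_essential
  refine ⟨h.injective.of_linearEquiv e, e.toLinearMap ∘ₗ f, e.injective.comp hf, fun P hP ↦ ?_⟩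
  have hP' : P.comap e.toLinearMap = ⊥ := by
    refine hess _ ((Submodule.eq_bot_iff _).mpr ?_)
    rintro _ ⟨hx, y, rfl⟩
    have : e (f y) ∈ P ⊓ LinearMap.range (e.toLinearMap ∘ₗ f) := ⟨hx, y, rfl⟩
    rw [hP, Submodule.mem_bot] at this
    simpa using this
  refine (Submodule.eq_bot_iff _).mpr fun x hx ↦ ?_
  have : e.symm x ∈ P.comap e.toLinearMap := by simpa using hx
  rw [hP', Submodule.mem_bot] at this
  simpa using this

/-- An injective module over a local ring all of whose elements are killed by powers of a fixed
element `ϖ`, and in which the kernel of `ϖ` is a copy of the residue field generated by `m₀`, is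
an injective hull of the residue field: the last nonzero multiple `ϖ ^ n • m` of a nonzero
element `m` lies in that kernel. -/
theorem of_torsion {A : Type u} [CommRing A] [IsLocalRing A] {M : Type u}
    [AddCommGroup M] [Module A M] (hM : Module.Injective A M) (ϖ : A) (m₀ : M)
    (hann : ∀ a : A, a • m₀ = 0 ↔ a ∈ maximalIdeal A)
    (hsoc : ∀ m : M, ϖ • m = 0 → ∃ a : A, a • m₀ = m)
    (htors : ∀ m : M, ∃ n : ℕ, ϖ ^ n • m = 0) :
    IsInjectiveHull A (ResidueField A) M := by
  let f : ResidueField A →ₗ[A] M :=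
    Submodule.liftQ (maximalIdeal A) (LinearMap.toSpanSingleton A M m₀)
      (fun a ha ↦ (hann a).mpr ha)
  refine ⟨hM, f, ?_, fun N hN ↦ ?_⟩
  · refine (injective_iff_map_eq_zero f).mpr fun x hx ↦ ?_
    obtain ⟨a, rfl⟩ := Submodule.Quotient.mk_surjective _ x
    exact (Submodule.Quotient.mk_eq_zero _).mpr ((hann a).mp hx)
  · refine (Submodule.eq_bot_iff _).mpr fun m hm ↦ ?_
    classical
    have hlast := Nat.find_spec (htors m)
    rcases hn : Nat.find (htors m) with _ | n
    · simpa [hn] using hlast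
    · rw [hn, pow_succ', mul_smul] at hlast
      obtain ⟨a, ha⟩ := hsoc _ hlast
      have hmem : ϖ ^ n • m ∈ N ⊓ LinearMap.range f :=
        ⟨N.smul_mem _ hm, Submodule.Quotient.mk a, ha⟩
      rw [hN, Submodule.mem_bot] at hmem
      exact absurd hmem (Nat.find_min (htors m) (by omega))

/-- Injective hulls are unique up to isomorphism. -/
theorem nonempty_linearEquiv {A : Type u} [CommRing A] {k M N : Type u} [AddCommGroup k]
    [Module A k] [AddCommGroup M] [Module A M] [AddCommGroup N] [Module A N]
    (hM : IsInjectiveHull A k M) (hN : IsInjectiveHull A k N) : Nonempty (M ≃ₗ[A] N) := by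
  obtain ⟨f, hf, hfess⟩ := hM.exists_essential
  obtain ⟨g, hg, hgess⟩ := hN.exists_essential
  obtain ⟨φ, hφ⟩ := hN.injective.out f hf g
  have hφinj : Function.Injective φ := by
    refine LinearMap.ker_eq_bot.mp (hfess _ ((Submodule.eq_bot_iff _).mpr ?_))
    rintro _ ⟨hx, y, rfl⟩
    have : g y = 0 := by rw [← hφ]; exact hx
    rw [(injective_iff_map_eq_zero g).mp hg y this, map_zero]
  obtain ⟨ψ, hψ⟩ := hM.injective.out φ hφinj LinearMap.id
  have hψinj : Function.Injective ψ := by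
    refine LinearMap.ker_eq_bot.mp (hgess _ ((Submodule.eq_bot_iff _).mpr ?_))
    rintro _ ⟨hx, y, rfl⟩
    have : f y = 0 := by
      have h := hψ (f y)
      rw [hφ] at h
      exact h.symm.trans hx
    rw [(injective_iff_map_eq_zero f).mp hf y this, map_zero]
  exact ⟨(LinearEquiv.ofBijective ψ ⟨hψinj, fun x ↦ ⟨φ x, hψ x⟩⟩).symm⟩

end IsInjectiveHull

/-! ### `Ext` through a short injective resolution -/

section Ext

variable {R : Type u} [CommRing R] {A I J : Type u} [AddCommGroup A] [Module R A]
  [AddCommGroup I] [Module R I] [AddCommGroup J] [Module R J]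

theorem ExtOver.subsingleton_of_injective_resolution (S : Type u) [CommRing S] [Algebra R S]
    (ι : A →ₗ[R] I) (q : I →ₗ[R] J) (hι : Function.Injective ι) (hq : Function.Surjective q)
    (hex : Function.Exact ι q) (hI : Module.Injective R I) (hJ : Module.Injective R J)
    {i : ℕ} (hi : 2 ≤ i) : Subsingleton (ExtOver R S A i) := by
  have hT : (ShortComplex.moduleCatMk ι q hex.linearMap_comp_eq_zero).ShortExact :=
    ModuleCat.shortComplex_shortExact _ hex hι hq
  obtain ⟨n, rfl⟩ : ∃ n, i = n + 1 + 1 := ⟨i - 2, by omega⟩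
  have := Module.injective_object_of_injective_module R I
  have := Module.injective_object_of_injective_module R J
  refine subsingleton_of_forall_eq 0 fun e ↦ ?_
  obtain ⟨e', he'⟩ := Abelian.Ext.covariant_sequence_exact₁ (ModuleCat.of R S) hT e
    (Abelian.Ext.eq_zero_of_injective (I := ModuleCat.of R I) _) rfl
  rw [Abelian.Ext.eq_zero_of_injective (I := ModuleCat.of R J) e'] at he'
  exact he'.symm.trans (Abelian.Ext.zero_comp _ _ _ _ _)

theorem ExtOver.subsingleton_zero (S : Type u) [CommRing S] [Algebra R S]
    (h : ∀ f : S →ₗ[R] A, f = 0) : Subsingleton (ExtOver R S A 0) := by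
  refine subsingleton_of_forall_eq 0 fun e ↦ ?_
  obtain ⟨f, hf⟩ := (Abelian.Ext.mk₀_bijective (ModuleCat.of R S) (ModuleCat.of R A)).2 e
  have : f = 0 := by
    ext x
    exact LinearMap.congr_fun (h f.hom) x
  rw [← hf, this]
  exact Abelian.Ext.mk₀_zero _ _

/-- The connecting map `Hom_R(S, J) → Ext¹_R(S, A)` of a short exact sequence `0 → A → I → J → 0`
with `I` injective. It is linear over `S` acting on `Hom_R(S, J)` through the source; this action
is written out in order not to interfere with the action through `J` when `J` is an `S`-module. -/
theorem ExtOver.exists_connecting (S : Type u) [CommRing S] [Algebra R S]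
    (ι : A →ₗ[R] I) (q : I →ₗ[R] J) (hι : Function.Injective ι) (hq : Function.Surjective q)
    (hex : Function.Exact ι q) (hI : Module.Injective R I) :
    ∃ δ : (S →ₗ[R] J) →+ ExtOver R S A 1,
      (∀ (s : S) (f : S →ₗ[R] J), δ (f ∘ₗ LinearMap.mulLeft R s) = s • δ f) ∧
      Function.Surjective δ ∧ ∀ f, δ f = 0 ↔ ∃ g : S →ₗ[R] I, q ∘ₗ g = f := by
  have hT : (ShortComplex.moduleCatMk ι q hex.linearMap_comp_eq_zero).ShortExact :=
    ModuleCat.shortComplex_shortExact _ hex hι hq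
  have := Module.injective_object_of_injective_module R I
  let d (f : S →ₗ[R] J) : ExtOver R S A 1 :=
    (Abelian.Ext.mk₀ (ModuleCat.ofHom f)).comp hT.extClass (zero_add 1)
  have hd (f g) : d (f + g) = d f + d g := by
    refine (congrArg (fun x ↦ Abelian.Ext.comp x hT.extClass (zero_add 1))
      (Abelian.Ext.mk₀_add (ModuleCat.ofHom f) (ModuleCat.ofHom g))).trans ?_
    exact Abelian.Ext.add_comp _ _ _ _
  refine ⟨AddMonoidHom.mk' d hd, fun s f ↦ ?_, fun e ↦ ?_, fun f ↦ ⟨fun h ↦ ?_, ?_⟩⟩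
  · exact (Abelian.Ext.mk₀_comp_mk₀_assoc (ExtOver.mulHom R S s) (ModuleCat.ofHom f)
      hT.extClass).symm
  · obtain ⟨e', he'⟩ := Abelian.Ext.covariant_sequence_exact₁ (ModuleCat.of R S) hT e
      (Abelian.Ext.eq_zero_of_injective (I := ModuleCat.of R I) _) rfl
    obtain ⟨f, rfl⟩ := (Abelian.Ext.mk₀_bijective _ _).2 e'
    exact ⟨f.hom, he'⟩
  · obtain ⟨e', he'⟩ := Abelian.Ext.covariant_sequence_exact₃ (ModuleCat.of R S) hT _ (zero_add 1) h
    obtain ⟨g, rfl⟩ := (Abelian.Ext.mk₀_bijective _ _).2 e'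
    rw [Abelian.Ext.mk₀_comp_mk₀] at he'
    exact ⟨g.hom, congrArg ModuleCat.Hom.hom ((Abelian.Ext.mk₀_bijective _ _).1 he')⟩
  · rintro ⟨g, rfl⟩
    refine (Abelian.Ext.mk₀_comp_mk₀_assoc (ModuleCat.ofHom g)
      (ShortComplex.moduleCatMk ι q hex.linearMap_comp_eq_zero).g hT.extClass).symm.trans ?_
    exact (congrArg (fun e ↦ (Abelian.Ext.mk₀ (ModuleCat.ofHom g)).comp e (zero_add 1))
      hT.comp_extClass).trans (Abelian.Ext.comp_zero _ _ _ _ _)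

end Ext

/-! ### Dimension counts -/

open Cardinal in
/-- An `L`-vector space into which the `K`-dual of an infinite extension `L / K` embeds has
uncountable dimension: by Erdős–Kaplansky the dual has `K`-dimension larger than `[L : K]`, while
countable dimension over `L` would give `K`-dimension at most `[L : K]`. -/
theorem aleph0_lt_rank_of_dual_injective {K L V : Type u} [Field K] [Field L] [Algebra K L]
    [AddCommGroup V] [Module K V] [Module L V] [IsScalarTower K L V]
    (hKL : ¬ Module.Finite K L) (φ : (L →ₗ[K] K) →ₗ[K] V) (hφ : Function.Injective φ) :
    ℵ₀ < Module.rank L V := by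
  by_contra! hV
  have hL : ℵ₀ ≤ Module.rank K L := by
    by_contra! h
    exact hKL (Module.rank_lt_aleph0_iff.mp h)
  have h1 := rank_lt_rank_dual hL
  have h2 := LinearMap.rank_le_of_injective φ hφ
  have h3 : Module.rank K V ≤ Module.rank K L := by
    rw [← rank_mul_rank K L V]
    exact (mul_le_mul_right hV _).trans (mul_aleph0_eq hL).le
  exact absurd (h1.trans_le (h2.trans h3)) (lt_irrefl _)

open TensorProduct in
/-- A module over a domain `S` on which the nonzero elements of `S` act bijectively does not change
under extension of scalars to the fraction field. -/
theorem bijective_mk_one_of_bijective_smul {S L Q : Type*} [CommRing S] [IsDomain S] [Field L]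
    [Algebra S L] [IsFractionRing S L] [AddCommGroup Q] [Module S Q]
    (h : ∀ s : S, s ≠ 0 → Function.Bijective fun q : Q ↦ s • q) :
    Function.Bijective (TensorProduct.mk S L Q 1) := by
  have hloc : IsLocalizedModule (nonZeroDivisors S) (TensorProduct.mk S L Q 1) := inferInstance
  refine ⟨fun x y hxy ↦ ?_, fun v ↦ ?_⟩
  · obtain ⟨c, hc⟩ := (IsLocalizedModule.eq_iff_exists (nonZeroDivisors S) _).mp hxy
    exact (h c (nonZeroDivisors.coe_ne_zero c)).1 hc
  · obtain ⟨⟨x, s⟩, hs⟩ := IsLocalizedModule.surj (nonZeroDivisors S) (TensorProduct.mk S L Q 1) v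
    obtain ⟨y, hy⟩ := (h s (nonZeroDivisors.coe_ne_zero s)).2 x
    refine ⟨y, IsLocalizedModule.smul_injective (TensorProduct.mk S L Q 1) s ?_⟩
    change s • _ = s • v
    rw [hs, ← hy]
    exact (map_smul (TensorProduct.mk S L Q 1) (s : S) y).symm

/-! ### Discrete valuation rings and their fraction fields -/

theorem IsDiscreteValuationRing.of_maximalIdeal_eq_span {A : Type u} [CommRing A] [IsDomain A]
    [IsLocalRing A] {p : A} (hp0 : p ≠ 0) (hp : IsLocalRing.maximalIdeal A = Ideal.span {p})
    (hsep : ∀ x : A, (∀ n : ℕ, p ^ n ∣ x) → x = 0) : IsDiscreteValuationRing A := by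
  refine IsDiscreteValuationRing.ofHasUnitMulPowIrreducibleFactorization
    ⟨p, irreducible_of_span_eq_maximalIdeal p hp0 hp, fun {x} hx ↦ ?_⟩
  have hfin : FiniteMultiplicity p x := by
    by_contra h
    exact hx (hsep x (fun n ↦ FiniteMultiplicity.not_iff_forall.mp h n))
  obtain ⟨c, hxc, hc⟩ := hfin.exists_eq_pow_mul_and_not_dvd
  have hu : IsUnit c := by
    rw [← not_not (a := IsUnit c), ← mem_nonunits_iff, ← mem_maximalIdeal, hp,
      Ideal.mem_span_singleton]
    exact hc
  exact ⟨_, hu.unit, hxc.symm⟩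

section FractionField

variable {A : Type u} [CommRing A] [IsDomain A] [IsDiscreteValuationRing A] {F : Type u} [Field F]
  [Algebra A F] [IsFractionRing A F] {p : A}

theorem exists_pow_mul_mem_range (hp : Irreducible p) (x : F) :
    ∃ (n : ℕ) (a : A), algebraMap A F p ^ n * x = algebraMap A F a := by
  obtain ⟨a, b, hb, rfl⟩ := IsFractionRing.div_surjective (A := A) x
  obtain ⟨n, u, rfl⟩ := IsDiscreteValuationRing.eq_unit_mul_pow_irreducible
    (nonZeroDivisors.ne_zero hb) hp
  refine ⟨n, ↑u⁻¹ * a, ?_⟩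
  have hp0 : algebraMap A F p ≠ 0 := by simpa using hp.ne_zero
  have hu : algebraMap A F u * algebraMap A F ↑u⁻¹ = 1 := by rw [← map_mul]; simp
  have hu0 : algebraMap A F u ≠ 0 := left_ne_zero_of_mul_eq_one hu
  simp only [map_mul, map_pow]
  field_simp
  rw [mul_assoc, hu, mul_one]

/-- The quotient `F / A` of the fraction field of a domain by the domain; for a discrete valuation
ring it is the standard model of the injective hull of the residue field. -/
abbrev FracQuot (A : Type u) [CommRing A] (F : Type u) [Field F] [Algebra A F] : Type u :=
  F ⧸ LinearMap.range (Algebra.linearMap A F)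

/-- The projection `F → F / A`. -/
abbrev FracQuot.mk (A : Type u) [CommRing A] {F : Type u} [Field F] [Algebra A F] :
    F →ₗ[A] FracQuot A F :=
  Submodule.mkQ (LinearMap.range (Algebra.linearMap A F))

omit [IsDomain A] [IsDiscreteValuationRing A] [IsFractionRing A F] in
theorem FracQuot.mk_eq_zero {x : F} : FracQuot.mk A x = 0 ↔ ∃ a : A, algebraMap A F a = x := by
  simp

theorem FracQuot.exists_pow_smul_eq_zero (hp : Irreducible p) (m : FracQuot A F) :
    ∃ n : ℕ, p ^ n • m = 0 := by
  obtain ⟨x, rfl⟩ := Submodule.mkQ_surjective _ m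
  obtain ⟨n, a, h⟩ := exists_pow_mul_mem_range hp x
  refine ⟨n, ?_⟩
  rw [← map_smul, FracQuot.mk_eq_zero]
  exact ⟨a, by rw [← h, Algebra.smul_def, map_pow]⟩

omit [IsDomain A] [IsDiscreteValuationRing A] in
theorem FracQuot.exists_smul_eq {a : A} (ha : a ≠ 0) (m : FracQuot A F) : ∃ m', a • m' = m := by
  obtain ⟨x, rfl⟩ := Submodule.mkQ_surjective _ m
  have ha' : algebraMap A F a ≠ 0 := by simpa using ha
  refine ⟨FracQuot.mk A ((algebraMap A F a)⁻¹ * x), ?_⟩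
  rw [← map_smul, Algebra.smul_def, mul_inv_cancel_left₀ ha']

theorem FracQuot.smul_mk_inv_eq_zero (hp : Irreducible p) (a : A) :
    a • FracQuot.mk A (algebraMap A F p)⁻¹ = 0 ↔ a ∈ maximalIdeal A := by
  have hp0 : algebraMap A F p ≠ 0 := by simpa using hp.ne_zero
  rw [← map_smul, FracQuot.mk_eq_zero, hp.maximalIdeal_eq, Ideal.mem_span_singleton, Algebra.smul_def]
  constructor
  · rintro ⟨b, hb⟩
    refine ⟨b, IsFractionRing.injective A F ?_⟩
    rw [map_mul, hb]
    field_simp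
  · rintro ⟨b, rfl⟩
    exact ⟨b, by rw [map_mul]; field_simp⟩

omit [IsDomain A] [IsDiscreteValuationRing A] in
theorem FracQuot.exists_smul_mk_inv_eq (hp : p ≠ 0) (m : FracQuot A F) (hm : p • m = 0) :
    ∃ a : A, a • FracQuot.mk A (algebraMap A F p)⁻¹ = m := by
  have hp0 : algebraMap A F p ≠ 0 := by simpa using hp
  obtain ⟨x, rfl⟩ := Submodule.mkQ_surjective _ m
  rw [← map_smul, FracQuot.mk_eq_zero] at hm
  obtain ⟨a, ha⟩ := hm
  refine ⟨a, ?_⟩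
  rw [← map_smul, Algebra.smul_def, ha, Algebra.smul_def]
  congr 1
  field_simp

variable (A F) in
theorem FracQuot.injective : Module.Injective A (FracQuot A F) :=
  .of_divisible fun _ ha m ↦ FracQuot.exists_smul_eq ha m

variable (A F) in
theorem FracQuot.isInjectiveHull : IsInjectiveHull A (ResidueField A) (FracQuot A F) := by
  obtain ⟨p, hp⟩ := IsDiscreteValuationRing.exists_irreducible A
  exact .of_torsion (FracQuot.injective A F) p _ (FracQuot.smul_mk_inv_eq_zero hp)
    (FracQuot.exists_smul_mk_inv_eq hp.ne_zero) (FracQuot.exists_pow_smul_eq_zero hp)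

end FractionField

/-! ### Immediate extensions of discrete valuation rings -/

/-- The extension `R → S` of local domains is immediate: some element `ϖ` of `R` is a uniformizer of
both rings, and the residue fields agree (`S = R + ϖ S`). -/
structure IsImmediate (R S : Type u) [CommRing R] [CommRing S] [Algebra R S] (ϖ : R) : Prop where
  irreducible : Irreducible ϖ
  irreducible_map : Irreducible (algebraMap R S ϖ)
  exists_add (x : S) : ∃ (r : R) (s : S), x = algebraMap R S r + algebraMap R S ϖ * s

namespace IsImmediate

variable {R S : Type u} [CommRing R] [CommRing S] [Algebra R S] {ϖ : R}

theorem exists_add_pow (h : IsImmediate R S ϖ) (n : ℕ) (x : S) :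
    ∃ (r : R) (s : S), x = algebraMap R S r + algebraMap R S (ϖ ^ n) * s := by
  induction n with
  | zero => exact ⟨0, x, by simp⟩
  | succ n ih =>
    obtain ⟨r, s, rfl⟩ := ih
    obtain ⟨r', s', rfl⟩ := h.exists_add s
    exact ⟨r + ϖ ^ n * r', s', by simp only [map_add, map_mul, pow_succ]; ring⟩

/-- An `R`-linear map out of `S` is `S`-linear up to multiples of any power of `ϖ`, since `R` is
dense in `S`. -/
theorem exists_pow_smul_eq_sub (h : IsImmediate R S ϖ) {N : Type*} [AddCommGroup N] [Module R N]
    [Module S N] [IsScalarTower R S N] (f : S →ₗ[R] N) (n : ℕ) (x : S) :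
    ∃ s : S, f x - x • f 1 = ϖ ^ n • (f s - s • f 1) := by
  obtain ⟨r, s, rfl⟩ := h.exists_add_pow n x
  refine ⟨s, ?_⟩
  have h1 : f (algebraMap R S r) = r • f 1 := by
    rw [← map_smul, Algebra.smul_def, mul_one]
  have h2 : f (algebraMap R S (ϖ ^ n) * s) = ϖ ^ n • f s := by
    rw [← map_smul, Algebra.smul_def]
  rw [map_add, h1, h2, add_smul, mul_smul, algebraMap_smul, algebraMap_smul, smul_sub]
  abel

theorem apply_eq_smul_of_smul_eq_zero (h : IsImmediate R S ϖ) {N : Type*} [AddCommGroup N]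
    [Module R N] [Module S N] [IsScalarTower R S N] (f : S →ₗ[R] N) (hf : ϖ • f = 0) (x : S) :
    f x = x • f 1 := by
  have hf' (y : S) : ϖ • f y = 0 := LinearMap.congr_fun hf y
  obtain ⟨s, hs⟩ := h.exists_pow_smul_eq_sub f 1 x
  rw [pow_one, smul_sub, hf', smul_comm, hf', smul_zero, sub_zero] at hs
  exact sub_eq_zero.mp hs

variable [IsDomain S] [IsDiscreteValuationRing S]

theorem apply_eq_mul (h : IsImmediate R S ϖ) (f : S →ₗ[R] S) (x : S) : f x = x * f 1 := by
  rw [← sub_eq_zero]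
  by_contra hne
  have hfin : FiniteMultiplicity (algebraMap R S ϖ) (f x - x * f 1) :=
    FiniteMultiplicity.of_not_isUnit h.irreducible_map.not_isUnit hne
  refine FiniteMultiplicity.not_iff_forall.mpr (fun n ↦ ?_) hfin
  obtain ⟨s, hs⟩ := h.exists_pow_smul_eq_sub f n x
  rw [smul_eq_mul] at hs
  rw [hs, Algebra.smul_def, map_pow]
  exact dvd_mul_right _ _

variable {K L : Type u} [Field K] [Field L] [Algebra R K] [Algebra S L]
  [IsFractionRing S L] [Algebra R L] [IsScalarTower R S L]

/-- `L / S` is also an injective hull of the residue field over `R`. -/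
theorem isInjectiveHull [IsDomain R] [IsDiscreteValuationRing R] (h : IsImmediate R S ϖ) :
    IsInjectiveHull R (ResidueField R) (FracQuot S L) := by
  have hne {a : R} (ha : a ≠ 0) : algebraMap R S a ≠ 0 := by
    obtain ⟨n, u, rfl⟩ := IsDiscreteValuationRing.eq_unit_mul_pow_irreducible ha h.irreducible
    rw [map_mul, map_pow]
    exact mul_ne_zero (u.isUnit.map _).ne_zero (pow_ne_zero _ h.irreducible_map.ne_zero)
  refine .of_torsion (.of_divisible fun a ha m ↦ ?_) ϖ
    (FracQuot.mk S (algebraMap S L (algebraMap R S ϖ))⁻¹) (fun a ↦ ?_) (fun m hm ↦ ?_) fun m ↦ ?_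
  · obtain ⟨m', hm'⟩ := FracQuot.exists_smul_eq (hne ha) m
    exact ⟨m', by rw [← hm', algebraMap_smul]⟩
  · rw [← algebraMap_smul S a, FracQuot.smul_mk_inv_eq_zero h.irreducible_map]
    rw [mem_maximalIdeal, mem_maximalIdeal, mem_nonunits_iff, mem_nonunits_iff]
    refine not_congr ⟨fun hu ↦ ?_, fun hu ↦ hu.map _⟩
    by_contra hn
    rw [← mem_nonunits_iff, ← mem_maximalIdeal, h.irreducible.maximalIdeal_eq,
      Ideal.mem_span_singleton] at hn
    exact h.irreducible_map.not_isUnit (isUnit_of_dvd_unit (map_dvd (algebraMap R S) hn) hu)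
  · obtain ⟨a, rfl⟩ := FracQuot.exists_smul_mk_inv_eq h.irreducible_map.ne_zero m
      (by rw [algebraMap_smul, hm])
    obtain ⟨r, s, rfl⟩ := h.exists_add a
    refine ⟨r, ?_⟩
    rw [add_smul, algebraMap_smul, mul_comm, mul_smul,
      (FracQuot.smul_mk_inv_eq_zero h.irreducible_map _).mpr, smul_zero, add_zero]
    rw [mem_maximalIdeal]
    exact h.irreducible_map.not_isUnit
  · obtain ⟨n, hn⟩ := FracQuot.exists_pow_smul_eq_zero h.irreducible_map m
    exact ⟨n, by rwa [← map_pow, algebraMap_smul] at hn⟩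

variable [Algebra K L] [IsScalarTower R K L]

variable (R S K L) in
/-- The map `K → L / S`. -/
def toFracQuot : K →ₗ[R] FracQuot S L :=
  (FracQuot.mk S).restrictScalars R ∘ₗ (Algebra.linearMap K L).restrictScalars R

omit [IsDomain S] [IsDiscreteValuationRing S] [IsFractionRing S L] in
theorem toFracQuot_apply (k : K) : toFracQuot R S K L k = FracQuot.mk S (algebraMap K L k) := rfl

variable [IsDomain R] [IsDiscreteValuationRing R] [IsFractionRing R K]

omit [IsDomain R] [IsDiscreteValuationRing R] in
/-- `L = K + S`. -/
theorem toFracQuot_surjective (h : IsImmediate R S ϖ) :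
    Function.Surjective (toFracQuot R S K L) := by
  intro m
  obtain ⟨x, rfl⟩ := Submodule.mkQ_surjective _ m
  obtain ⟨n, a, ha⟩ := exists_pow_mul_mem_range h.irreducible_map x
  obtain ⟨r, s, rfl⟩ := h.exists_add_pow n a
  have hK0 : algebraMap R K ϖ ≠ 0 := by simpa using h.irreducible.ne_zero
  have hL0 : algebraMap S L (algebraMap R S ϖ) ≠ 0 := by
    simpa using h.irreducible_map.ne_zero
  refine ⟨algebraMap R K r / algebraMap R K ϖ ^ n, ?_⟩
  rw [toFracQuot_apply, ← sub_eq_zero, ← map_sub, FracQuot.mk_eq_zero]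
  refine ⟨-s, ?_⟩
  have e (y : R) : algebraMap K L (algebraMap R K y) = algebraMap S L (algebraMap R S y) := by
    rw [← IsScalarTower.algebraMap_apply, ← IsScalarTower.algebraMap_apply]
  rw [map_div₀, map_pow, e, e, eq_sub_iff_add_eq, eq_div_iff (pow_ne_zero _ hL0), add_mul,
    mul_comm x, ha]
  simp only [map_neg, map_add, map_mul, map_pow]
  ring

omit [IsDomain S] [IsDiscreteValuationRing S] in
/-- `K ∩ S = R`. -/
theorem exact_toFracQuot (h : IsImmediate R S ϖ) :
    Function.Exact (Algebra.linearMap R K) (toFracQuot R S K L) := by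
  have e (y : R) : algebraMap K L (algebraMap R K y) = algebraMap S L (algebraMap R S y) := by
    rw [← IsScalarTower.algebraMap_apply, ← IsScalarTower.algebraMap_apply]
  intro k
  rw [toFracQuot_apply, FracQuot.mk_eq_zero]
  constructor
  · rintro ⟨s, hs⟩
    obtain hk | hk := ValuationRing.isInteger_or_isInteger R k
    · exact hk
    obtain ⟨r, hr⟩ := hk
    obtain rfl | hk0 := eq_or_ne k 0
    · exact ⟨0, map_zero _⟩
    have hrs : algebraMap R S r * s = 1 := by
      apply IsFractionRing.injective S L
      rw [map_mul, hs, ← e, hr, ← map_mul, inv_mul_cancel₀ hk0, map_one, map_one]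
    have hu : IsUnit r := by
      by_contra hn
      rw [← mem_nonunits_iff, ← mem_maximalIdeal, h.irreducible.maximalIdeal_eq,
        Ideal.mem_span_singleton] at hn
      exact h.irreducible_map.not_isUnit (isUnit_of_dvd_unit (map_dvd (algebraMap R S) hn)
        (IsUnit.of_mul_eq_one _ hrs))
    obtain ⟨u, rfl⟩ := hu
    refine ⟨↑u⁻¹, ?_⟩
    have h1 : algebraMap R K u * algebraMap R K ↑u⁻¹ = 1 := by rw [← map_mul]; simp
    rw [hr] at h1
    rw [Algebra.linearMap_apply, ← inv_inv k]
    exact eq_inv_of_mul_eq_one_right h1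
  · rintro ⟨r, rfl⟩
    exact ⟨algebraMap R S r, (e r).symm⟩

omit [IsDomain R] [IsDiscreteValuationRing R] in
/-- `L = K S`. -/
theorem eq_top_of_forall_mem_submodule (h : IsImmediate R S ϖ) (P : Submodule K L)
    (hP : ∀ s : S, algebraMap S L s ∈ P) : P = ⊤ := by
  have hK0 : algebraMap R K ϖ ≠ 0 := by simpa using h.irreducible.ne_zero
  refine eq_top_iff.mpr fun x _ ↦ ?_
  obtain ⟨n, a, ha⟩ := exists_pow_mul_mem_range h.irreducible_map x
  have hx : x = ((algebraMap R K ϖ ^ n)⁻¹ : K) • algebraMap S L a := by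
    rw [eq_inv_smul_iff₀ (pow_ne_zero _ hK0), ← ha, Algebra.smul_def, map_pow,
      ← IsScalarTower.algebraMap_apply, ← IsScalarTower.algebraMap_apply]
  rw [hx]
  exact P.smul_mem _ (hP a)

omit [IsDomain R] [IsDiscreteValuationRing R] in
theorem finite_of_forall_mem_submodule (h : IsImmediate R S ϖ) (P : Submodule K L)
    (hfg : P.FG) (hP : ∀ s : S, algebraMap S L s ∈ P) : Module.Finite K L := by
  rw [h.eq_top_of_forall_mem_submodule P hP] at hfg
  exact Module.finite_def.mpr hfg

omit [IsDomain S] [IsDiscreteValuationRing S] in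
theorem exists_notMem_range (hKL : ¬ Module.Finite K L) : ∃ t : L, t ∉ (⊥ : Subalgebra K L) := by
  by_contra! ht
  exact hKL (.of_surjective (Algebra.linearMap K L) fun x ↦ Algebra.mem_bot.mp (ht x))

omit [IsDomain R] [IsDiscreteValuationRing R] in
/-- `Hom_R(S, R) = 0`: such a map is multiplication by some `c ∈ R`, so if `c ≠ 0` then
`S ⊆ c⁻¹ R ⊆ K`. -/
theorem linearMap_eq_zero (h : IsImmediate R S ϖ) (hKL : ¬ Module.Finite K L) (f : S →ₗ[R] R) :
    f = 0 := by
  have e (y : R) : algebraMap K L (algebraMap R K y) = algebraMap S L (algebraMap R S y) := by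
    rw [← IsScalarTower.algebraMap_apply, ← IsScalarTower.algebraMap_apply]
  have hf (x : S) : algebraMap R S (f x) = x * algebraMap R S (f 1) :=
    h.apply_eq_mul (Algebra.linearMap R S ∘ₗ f) x
  have hfL (x : S) : algebraMap K L (algebraMap R K (f x)) =
      algebraMap S L x * algebraMap K L (algebraMap R K (f 1)) := by
    rw [e, hf, map_mul, e]
  have hinj : Function.Injective fun y : R ↦ algebraMap K L (algebraMap R K y) :=
    (algebraMap K L).injective.comp (IsFractionRing.injective R K)
  by_cases hc : algebraMap K L (algebraMap R K (f 1)) = 0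
  · ext x
    refine hinj ?_
    change algebraMap K L (algebraMap R K (f x)) = algebraMap K L (algebraMap R K 0)
    rw [hfL, hc]
    simp
  · refine absurd (h.finite_of_forall_mem_submodule (Submodule.span K {(1 : L)})
      (Submodule.fg_span (Set.finite_singleton _)) fun s ↦ ?_) hKL
    refine Submodule.mem_span_singleton.mpr ⟨algebraMap R K (f s) / algebraMap R K (f 1), ?_⟩
    rw [Algebra.smul_def, mul_one, map_div₀, hfL, mul_div_cancel_right₀ _ hc]

end IsImmediate

/-! ### The structure of `Ext¹` -/

/-- The homomorphism `δ : Hom_R(S, L / S) → X` presents the `S`-module `X` as the cokernel of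
`Hom_R(S, K) → Hom_R(S, L / S)`, for the action of `S` through the source. -/
structure IsConnecting (R S K L : Type u) [CommRing R] [CommRing S] [Algebra R S] [Field K]
    [Field L] [Algebra R K] [Algebra S L] [Algebra R L] [IsScalarTower R S L] [Algebra K L]
    [IsScalarTower R K L] {X : Type u} [AddCommGroup X] [Module S X]
    (δ : (S →ₗ[R] FracQuot S L) →+ X) : Prop where
  map_comp_mulLeft (s : S) (f : S →ₗ[R] FracQuot S L) : δ (f ∘ₗ LinearMap.mulLeft R s) = s • δ f
  surjective : Function.Surjective δ
  eq_zero_iff (f : S →ₗ[R] FracQuot S L) :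
    δ f = 0 ↔ ∃ g : S →ₗ[R] K, IsImmediate.toFracQuot R S K L ∘ₗ g = f

namespace IsConnecting

variable {R S K L : Type u} [CommRing R] [CommRing S] [Algebra R S] [Field K]
    [Field L] [Algebra R K] [Algebra S L] [Algebra R L] [IsScalarTower R S L] [Algebra K L]
    [IsScalarTower R K L] {X : Type u} [AddCommGroup X] [Module S X]
    {δ : (S →ₗ[R] FracQuot S L) →+ X} {ϖ : R}

variable (R) in
/-- The `S`-linear map `x ↦ x • m`, considered as an `R`-linear map. -/
def smulMap (m : FracQuot S L) : S →ₗ[R] FracQuot S L :=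
  (LinearMap.toSpanSingleton S _ m).restrictScalars R

theorem smulMap_apply (m : FracQuot S L) (x : S) : smulMap R m x = x • m := rfl

/-- The map `L / S → X` sending `m` to the class of `x ↦ x • m`. Its image is the torsion
submodule of `X`. -/
def torsionMap (hδ : IsConnecting R S K L δ) : FracQuot S L →ₗ[S] X where
  toFun m := δ (smulMap R m)
  map_add' m m' := by
    rw [← map_add]
    congr 1
    ext x
    simp [smulMap_apply]
  map_smul' s m := by
    rw [RingHom.id_apply, ← hδ.map_comp_mulLeft]
    congr 1
    ext x
    simp [smulMap_apply, mul_smul, smul_comm s x]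

theorem torsionMap_apply (hδ : IsConnecting R S K L δ) (m : FracQuot S L) :
    hδ.torsionMap m = δ (smulMap R m) := rfl

theorem map_smul (hδ : IsConnecting R S K L δ) (r : R) (f : S →ₗ[R] FracQuot S L) :
    δ (r • f) = algebraMap R S r • δ f := by
  rw [← hδ.map_comp_mulLeft]
  congr 1
  ext x
  rw [LinearMap.smul_apply, LinearMap.comp_apply, LinearMap.mulLeft_apply, ← Algebra.smul_def,
    _root_.map_smul]

variable [IsDomain S] [IsDiscreteValuationRing S] [IsFractionRing S L]
  [IsDomain R] [IsDiscreteValuationRing R] [IsFractionRing R K]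

theorem torsionMap_injective (hδ : IsConnecting R S K L δ) (h : IsImmediate R S ϖ)
    (hKL : ¬ Module.Finite K L) : Function.Injective hδ.torsionMap := by
  refine (injective_iff_map_eq_zero _).mpr fun m hm ↦ ?_
  obtain ⟨g, hg⟩ := (hδ.eq_zero_iff _).mp hm
  have hgx (x : S) : IsImmediate.toFracQuot R S K L (g x) = x • m := LinearMap.congr_fun hg x
  obtain ⟨n, hn⟩ := FracQuot.exists_pow_smul_eq_zero h.irreducible_map m
  have hK0 : algebraMap R K ϖ ≠ 0 := by simpa using h.irreducible.ne_zero
  -- `ϖ ^ n • g` takes values in `R`, hence vanishes.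
  have hval (x : S) : ∃ r : R, Algebra.linearMap R K r = (ϖ ^ n • g) x := by
    refine (h.exact_toFracQuot (K := K) (L := L) _).mp ?_
    rw [LinearMap.smul_apply, _root_.map_smul, hgx, ← algebraMap_smul S (ϖ ^ n) (x • m), map_pow,
      smul_comm, hn, smul_zero]
  let f : S →ₗ[R] R := LinearMap.codRestrictOfInjective (ϖ ^ n • g) (Algebra.linearMap R K)
    (IsFractionRing.injective R K) hval
  have hf : Algebra.linearMap R K (f 1) = (ϖ ^ n • g) 1 :=
    LinearMap.codRestrictOfInjective_comp_apply _ _ _ _ _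
  rw [h.linearMap_eq_zero hKL f, LinearMap.zero_apply, map_zero, LinearMap.smul_apply,
    Algebra.smul_def, map_pow] at hf
  have hg1 : g 1 = 0 := (mul_eq_zero_iff_left (pow_ne_zero n hK0)).mp hf.symm
  rw [← one_smul S m, ← hgx, hg1, map_zero]

omit [IsDomain S] [IsDiscreteValuationRing S] [IsDomain R] [IsDiscreteValuationRing R] in
/-- The cokernel of `L / S → X` is torsion-free: if `ϖ f` differs from the sum of a map
`x ↦ x • m` and of one that lifts to `K`, then dividing both by `ϖ` leaves a map killed by `ϖ`,
and such a map is `S`-linear. -/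
theorem mem_range_of_smul_mem_range (hδ : IsConnecting R S K L δ) (h : IsImmediate R S ϖ) (y : X)
    (hy : algebraMap R S ϖ • y ∈ LinearMap.range hδ.torsionMap) :
    y ∈ LinearMap.range hδ.torsionMap := by
  obtain ⟨f, rfl⟩ := hδ.surjective y
  obtain ⟨m, hm⟩ := hy
  rw [torsionMap_apply, ← hδ.map_smul, eq_comm, ← sub_eq_zero, ← map_sub, hδ.eq_zero_iff] at hm
  obtain ⟨g, hg⟩ := hm
  obtain ⟨m', rfl⟩ := FracQuot.exists_smul_eq h.irreducible_map.ne_zero m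
  have hK0 : algebraMap R K ϖ ≠ 0 := by simpa using h.irreducible.ne_zero
  let g' : S →ₗ[R] K := LinearMap.mulLeft R (algebraMap R K ϖ)⁻¹ ∘ₗ g
  have hg' (x : S) : ϖ • g' x = g x := by
    rw [Algebra.smul_def]
    exact mul_inv_cancel_left₀ hK0 _
  let f' : S →ₗ[R] FracQuot S L := f - smulMap R m' - IsImmediate.toFracQuot R S K L ∘ₗ g'
  have hf' : ϖ • f' = 0 := by
    ext x
    have hgx : IsImmediate.toFracQuot R S K L (g x) =
      ϖ • f x - x • algebraMap R S ϖ • m' := LinearMap.congr_fun hg x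
    change ϖ • (f x - x • m' - IsImmediate.toFracQuot R S K L (g' x)) = 0
    rw [smul_sub, smul_sub, ← _root_.map_smul (IsImmediate.toFracQuot R S K L), hg', hgx,
      algebraMap_smul, smul_comm x]
    abel
  have hf'eq : f' = smulMap R (f' 1) := by
    ext x
    exact h.apply_eq_smul_of_smul_eq_zero f' hf' x
  refine ⟨m' + f' 1, ?_⟩
  rw [map_add, torsionMap_apply, torsionMap_apply, ← hf'eq, ← map_add]
  have hz : δ (IsImmediate.toFracQuot R S K L ∘ₗ g') = 0 := (hδ.eq_zero_iff _).mpr ⟨g', rfl⟩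
  have : smulMap R m' + f' = f - IsImmediate.toFracQuot R S K L ∘ₗ g' := by
    simp only [f']
    abel
  rw [this, map_sub, hz, sub_zero]

omit [IsFractionRing R K] in
/-- `X` is divisible, since `L / S` is injective over `R`. -/
theorem exists_smul_eq (hδ : IsConnecting R S K L δ) (h : IsImmediate R S ϖ) (y : X) :
    ∃ y' : X, algebraMap R S ϖ • y' = y := by
  obtain ⟨f, rfl⟩ := hδ.surjective y
  obtain ⟨f', hf'⟩ := (h.isInjectiveHull (L := L)).injective.out
    (LinearMap.mulLeft R (algebraMap R S ϖ)) (mul_right_injective₀ h.irreducible_map.ne_zero) f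
  refine ⟨δ f', ?_⟩
  rw [← hδ.map_comp_mulLeft]
  congr 1
  ext x
  exact hf' x

theorem bijective_smul_quotient (hδ : IsConnecting R S K L δ) (h : IsImmediate R S ϖ) (s : S)
    (hs : s ≠ 0) :
    Function.Bijective fun q : X ⧸ LinearMap.range hδ.torsionMap ↦ s • q := by
  have hϖ : Function.Bijective
      fun q : X ⧸ LinearMap.range hδ.torsionMap ↦ algebraMap R S ϖ • q := by
    constructor
    · intro q q' hq
      obtain ⟨y, rfl⟩ := Submodule.Quotient.mk_surjective _ q
      obtain ⟨y', rfl⟩ := Submodule.Quotient.mk_surjective _ q'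
      refine (Submodule.Quotient.eq _).mpr (hδ.mem_range_of_smul_mem_range h _ ?_)
      rw [smul_sub]
      exact (Submodule.Quotient.eq _).mp hq
    · intro q
      obtain ⟨y, rfl⟩ := Submodule.Quotient.mk_surjective _ q
      obtain ⟨y', rfl⟩ := hδ.exists_smul_eq h y
      exact ⟨Submodule.Quotient.mk y', rfl⟩
  obtain ⟨n, u, rfl⟩ := IsDiscreteValuationRing.eq_unit_mul_pow_irreducible hs h.irreducible_map
  have hpow : Function.Bijective
      fun q : X ⧸ LinearMap.range hδ.torsionMap ↦ algebraMap R S ϖ ^ n • q := by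
    have := hϖ.iterate n
    rwa [smul_iterate] at this
  have hu : Function.Bijective fun q : X ⧸ LinearMap.range hδ.torsionMap ↦ (u : S) • q :=
    MulAction.bijective u
  have := hu.comp hpow
  simpa only [Function.comp_def, ← mul_smul] using this

/-- The class modulo torsion of `x ↦ φ(x) t mod S`, for `φ : L → K` and a fixed `t : L`. -/
def dualMap (hδ : IsConnecting R S K L δ) (t : L) [Module R X] [IsScalarTower R S X] :
    (L →ₗ[K] K) →ₗ[R] X ⧸ LinearMap.range hδ.torsionMap where
  toFun φ := Submodule.Quotient.mk (δ ((FracQuot.mk S).restrictScalars R ∘ₗ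
    (LinearMap.toSpanSingleton K L t).restrictScalars R ∘ₗ φ.restrictScalars R ∘ₗ
      (Algebra.linearMap S L).restrictScalars R))
  map_add' φ ψ := by
    rw [← Submodule.Quotient.mk_add, ← map_add]
    congr 2
    ext x
    simp [add_smul]
  map_smul' r φ := by
    rw [RingHom.id_apply, ← Submodule.Quotient.mk_smul, ← algebraMap_smul S r (δ _),
      ← hδ.map_smul]
    congr 2
    ext x
    simp

omit [IsDomain R] [IsDiscreteValuationRing R] in
/-- If `φ(x) t mod S` is the sum of a map `x ↦ x • m` and of one that lifts to `g : S → K`, then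
`φ(x) t = x c + g(x)` for a constant `c : L`. For `c ≠ 0` this would give `L = c⁻¹ (K + K t)`,
so `c = 0`, and `φ = 0` because `t ∉ K`. -/
theorem dualMap_injective (hδ : IsConnecting R S K L δ) (h : IsImmediate R S ϖ)
    (hKL : ¬ Module.Finite K L) {t : L} (ht : t ∉ (⊥ : Subalgebra K L))
    [Module R X] [IsScalarTower R S X] : Function.Injective (hδ.dualMap t) := by
  refine (injective_iff_map_eq_zero _).mpr fun φ hφ ↦ ?_
  obtain ⟨m, hm⟩ := (Submodule.Quotient.mk_eq_zero _).mp hφ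
  rw [torsionMap_apply, eq_comm, ← sub_eq_zero, ← map_sub, hδ.eq_zero_iff] at hm
  obtain ⟨g, hg⟩ := hm
  obtain ⟨c, rfl⟩ := Submodule.mkQ_surjective _ m
  -- `φ(x) t - x c - g(x)` lies in `S`, hence is multiplication by a constant.
  let F : S →ₗ[R] L := (LinearMap.toSpanSingleton K L t).restrictScalars R ∘ₗ
    φ.restrictScalars R ∘ₗ (Algebra.linearMap S L).restrictScalars R -
    (LinearMap.toSpanSingleton S L c).restrictScalars R -
    (Algebra.linearMap K L).restrictScalars R ∘ₗ g
  have hF (x : S) : F x = φ (algebraMap S L x) • t - x • c - algebraMap K L (g x) := rfl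
  have hval (x : S) : ∃ s : S, (Algebra.linearMap S L).restrictScalars R s = F x := by
    refine FracQuot.mk_eq_zero.mp ?_
    have hgx : FracQuot.mk S (algebraMap K L (g x)) =
      FracQuot.mk S (φ (algebraMap S L x) • t) - x • FracQuot.mk S c := LinearMap.congr_fun hg x
    rw [hF, map_sub, map_sub, _root_.map_smul (FracQuot.mk S) x, hgx, sub_self]
  let f : S →ₗ[R] S := LinearMap.codRestrictOfInjective F
    ((Algebra.linearMap S L).restrictScalars R) (IsFractionRing.injective S L) hval
  have hf (x : S) : (Algebra.linearMap S L).restrictScalars R (f x) = F x :=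
    LinearMap.codRestrictOfInjective_comp_apply _ _ _ _ _
  obtain ⟨d, hd⟩ : ∃ d : L, ∀ x : S,
      φ (algebraMap S L x) • t = algebraMap S L x * d + algebraMap K L (g x) := by
    refine ⟨c + algebraMap S L (f 1), fun x ↦ ?_⟩
    have h1 : algebraMap S L (f x) = F x := hf x
    rw [h.apply_eq_mul f x, map_mul, hF, Algebra.smul_def x c] at h1
    rw [mul_add, h1]
    ring
  have hd0 : d = 0 := by
    by_contra hd0
    refine hKL (h.finite_of_forall_mem_submodule (Submodule.span K {t * d⁻¹, d⁻¹})
      (Submodule.fg_span (Set.toFinite _)) fun x ↦ ?_)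
    refine Submodule.mem_span_pair.mpr ⟨φ (algebraMap S L x), -g x, ?_⟩
    rw [← smul_mul_assoc, hd x, Algebra.smul_def, map_neg]
    field_simp
    ring
  have hzero (x : S) : algebraMap S L x ∈ LinearMap.ker φ := by
    by_contra hx
    refine ht (Algebra.mem_bot.mpr ⟨g x / φ (algebraMap S L x), ?_⟩)
    have hx' : algebraMap K L (φ (algebraMap S L x)) ≠ 0 := by simpa using hx
    have := hd x
    rw [hd0, mul_zero, zero_add, Algebra.smul_def] at this
    rw [map_div₀, ← this, mul_div_cancel_left₀ _ hx']
  exact LinearMap.ker_eq_top.mp (h.eq_top_of_forall_mem_submodule _ hzero)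

/-- `X` is the direct sum of its torsion submodule `L / S`, which is injective, and of a vector
space over `L`, whose dimension is uncountable because it contains the `K`-dual of `L`. -/
theorem exists_linearEquiv (hδ : IsConnecting R S K L δ) (h : IsImmediate R S ϖ)
    (hKL : ¬ Module.Finite K L) :
    ∃ C : Type u, Uncountable C ∧ Nonempty (X ≃ₗ[S] FracQuot S L × (C →₀ L)) := by
  let : Module R X := Module.compHom X (algebraMap R S)
  have : IsScalarTower R S X := .of_algebraMap_smul fun _ _ ↦ rfl
  let Q := X ⧸ LinearMap.range hδ.torsionMap
  obtain ⟨ρ, hρ⟩ := (FracQuot.injective S L).out hδ.torsionMap (hδ.torsionMap_injective h hKL)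
    LinearMap.id
  have hρ' (m) : ρ (hδ.torsionMap m) = m := hρ m
  let e₁ : X ≃ₗ[S] FracQuot S L × Q := LinearEquiv.ofBijective (ρ.prod (Submodule.mkQ _)) <| by
    constructor
    · refine (injective_iff_map_eq_zero _).mpr fun y hy ↦ ?_
      obtain ⟨hy₁, hy₂⟩ := Prod.ext_iff.mp hy
      obtain ⟨m, rfl⟩ := (Submodule.Quotient.mk_eq_zero _).mp hy₂
      rw [← hρ' m]
      have : ρ (hδ.torsionMap m) = 0 := hy₁
      rw [this, map_zero]
    · rintro ⟨m, q⟩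
      obtain ⟨y, rfl⟩ := Submodule.mkQ_surjective _ q
      refine ⟨y + hδ.torsionMap (m - ρ y), Prod.ext ?_ ?_⟩
      · simp [hρ']
      · have : Submodule.mkQ (LinearMap.range hδ.torsionMap) (hδ.torsionMap (m - ρ y)) = 0 :=
          (Submodule.Quotient.mk_eq_zero _).mpr ⟨_, rfl⟩
        change Submodule.mkQ _ (y + _) = _
        rw [map_add, this, add_zero]
  let e₂ : Q ≃ₗ[S] TensorProduct S L Q := LinearEquiv.ofBijective (TensorProduct.mk S L Q 1)
    (bijective_mk_one_of_bijective_smul fun s hs ↦ hδ.bijective_smul_quotient h s hs)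
  let b := Module.Basis.ofVectorSpace L (TensorProduct S L Q)
  refine ⟨_, ?_, ⟨e₁ ≪≫ₗ .prodCongr (.refl S _) (e₂ ≪≫ₗ b.repr.restrictScalars S)⟩⟩
  obtain ⟨t, ht⟩ := IsImmediate.exists_notMem_range hKL
  let φ : (L →ₗ[K] K) →ₗ[R] TensorProduct S L Q :=
    (e₂.toLinearMap.restrictScalars R) ∘ₗ hδ.dualMap t
  have := aleph0_lt_rank_of_dual_injective hKL
    (φ.extendScalarsOfIsLocalization (nonZeroDivisors R) K)
    (e₂.injective.comp (hδ.dualMap_injective h hKL ht))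
  rw [← b.mk_eq_rank''] at this
  exact Cardinal.aleph0_lt_mk_iff.mp this

end IsConnecting

/-- `Ext_R(S, R)` for an immediate extension `R → S` of discrete valuation rings of infinite degree
on fraction fields, computed from the injective resolution `0 → R → K → L / S → 0`. Completeness of
`S` plays no role. -/
theorem IsImmediate.exists_ext_one_linearEquiv {R S : Type u} (K L : Type u) [CommRing R]
    [CommRing S] [Algebra R S]
    [Field K] [Field L] [Algebra R K] [Algebra S L] [Algebra R L] [IsScalarTower R S L]
    [Algebra K L] [IsScalarTower R K L] [IsDomain S] [IsDiscreteValuationRing S]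
    [IsFractionRing S L] [IsDomain R] [IsDiscreteValuationRing R] [IsFractionRing R K] {ϖ : R}
    (h : IsImmediate R S ϖ) (hKL : ¬ Module.Finite K L) :
    (∀ i : ℕ, i ≠ 1 → Subsingleton (ExtOver R S R i)) ∧ ∃ C : Type u, Uncountable C ∧
      Nonempty (ExtOver R S R 1 ≃ₗ[S] FracQuot S L × (C →₀ L)) := by
  have hK : Module.Injective R K := .of_divisible fun a ha x ↦
    ⟨(algebraMap R K a)⁻¹ * x, by
      rw [Algebra.smul_def, mul_inv_cancel_left₀ (by simpa using ha)]⟩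
  have hinj : Function.Injective (Algebra.linearMap R K) := IsFractionRing.injective R K
  refine ⟨fun i hi ↦ ?_, ?_⟩
  · obtain rfl | hi2 : i = 0 ∨ 2 ≤ i := by omega
    · exact ExtOver.subsingleton_zero S (h.linearMap_eq_zero hKL)
    · exact ExtOver.subsingleton_of_injective_resolution S _ _ hinj
        (h.toFracQuot_surjective (K := K) (L := L)) h.exact_toFracQuot hK
        h.isInjectiveHull.injective hi2
  · obtain ⟨δ, h₁, h₂, h₃⟩ := ExtOver.exists_connecting S _ _ hinj
      (h.toFracQuot_surjective (K := K) (L := L)) h.exact_toFracQuot hK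
    exact IsConnecting.exists_linearEquiv ⟨h₁, h₂, h₃⟩ h hKL

/-! ### The completion of a discrete valuation ring -/

section Completion

variable {R : Type u} [CommRing R] [IsDomain R] [IsDiscreteValuationRing R]

theorem maximalIdeal_adicCompletion {ϖ : R} (hϖ : Irreducible ϖ) :
    maximalIdeal (AdicCompletion (maximalIdeal R) R) =
      Ideal.span {algebraMap R (AdicCompletion (maximalIdeal R) R) ϖ} := by
  rw [AdicCompletion.maximalIdeal_eq_map, hϖ.maximalIdeal_eq, Ideal.map_span, Set.image_singleton]

theorem isDiscreteValuationRing_adicCompletion [IsDomain (AdicCompletion (maximalIdeal R) R)]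
    (hinj : Function.Injective (algebraMap R (AdicCompletion (maximalIdeal R) R))) :
    IsDiscreteValuationRing (AdicCompletion (maximalIdeal R) R) := by
  obtain ⟨ϖ, hϖ⟩ := IsDiscreteValuationRing.exists_irreducible R
  refine IsDiscreteValuationRing.of_maximalIdeal_eq_span
    (p := algebraMap R (AdicCompletion (maximalIdeal R) R) ϖ) ?_ (maximalIdeal_adicCompletion hϖ)
    fun x hx ↦ ?_
  · exact (map_ne_zero_iff _ hinj).mpr hϖ.ne_zero
  · have := AdicCompletion.isAdicComplete_self (maximalIdeal R)
      (maximalIdeal R).fg_of_isNoetherianRing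
    refine IsHausdorff.haus (I := (maximalIdeal R).map (algebraMap R
      (AdicCompletion (maximalIdeal R) R))) inferInstance x fun n ↦ ?_
    rw [SModEq.zero, smul_eq_mul, Ideal.mul_top, ← AdicCompletion.maximalIdeal_eq_map,
      maximalIdeal_adicCompletion hϖ, Ideal.span_singleton_pow, Ideal.mem_span_singleton]
    exact hx n

theorem isImmediate_adicCompletion [IsDomain (AdicCompletion (maximalIdeal R) R)]
    [IsDiscreteValuationRing (AdicCompletion (maximalIdeal R) R)] {ϖ : R} (hϖ : Irreducible ϖ) :
    IsImmediate R (AdicCompletion (maximalIdeal R) R) ϖ := by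
  refine ⟨hϖ, (IsDiscreteValuationRing.irreducible_iff_uniformizer _).mpr
    (maximalIdeal_adicCompletion hϖ), fun x ↦ ?_⟩
  obtain ⟨y, hy⟩ := (AdicCompletion.residueField_map_bijective R).2 (residue _ x)
  obtain ⟨r, rfl⟩ := residue_surjective y
  rw [ResidueField.map_residue, ← sub_eq_zero, ← map_sub, residue_eq_zero_iff,
    maximalIdeal_adicCompletion hϖ, Ideal.mem_span_singleton] at hy
  obtain ⟨s, hs⟩ := hy
  exact ⟨r, -s, by rw [mul_neg, ← hs]; ring⟩

end Completion

theorem proposition4p2 (R : Type u) [CommRing R] [IsDomain R] [IsDiscreteValuationRing R]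
    (hR : ¬ IsAdicComplete (maximalIdeal R) R)
    (K : Type v) [Field K] [Algebra R K] [IsFractionRing R K]
    (Kt : Type w) [Field Kt] [Algebra (AdicCompletion (maximalIdeal R) R) Kt]
    [IsFractionRing (AdicCompletion (maximalIdeal R) R) Kt]
    [Algebra R Kt] [IsScalarTower R (AdicCompletion (maximalIdeal R) R) Kt]
    [Algebra K Kt] [IsScalarTower R K Kt]
    (hK : ¬ Module.Finite K Kt)
    (E : Type u) [AddCommGroup E] [Module R E]
    (hE : IsInjectiveHull R (ResidueField R) E) :
    (∀ i : ℕ, i ≠ 1 → Subsingleton (ExtOver R (AdicCompletion (maximalIdeal R) R) R i)) ∧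
    ∃ _ : Module (AdicCompletion (maximalIdeal R) R) E,
      IsScalarTower R (AdicCompletion (maximalIdeal R) R) E ∧
      IsInjectiveHull (AdicCompletion (maximalIdeal R) R)
        (ResidueField (AdicCompletion (maximalIdeal R) R)) E ∧
      ∃ C : Type u, Uncountable C ∧
        Nonempty (ExtOver R (AdicCompletion (maximalIdeal R) R) R 1
          ≃ₗ[AdicCompletion (maximalIdeal R) R] E × (C →₀ Kt)) := by
  let S := AdicCompletion (maximalIdeal R) R
  have hinjR : Function.Injective (algebraMap R Kt) := by
    rw [IsScalarTower.algebraMap_eq R K Kt]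
    exact (algebraMap K Kt).injective.comp (IsFractionRing.injective R K)
  have hinj : Function.Injective (algebraMap R S) := by
    rw [IsScalarTower.algebraMap_eq R S Kt] at hinjR
    exact Function.Injective.of_comp hinjR
  have : IsDomain S := (IsFractionRing.injective S Kt).isDomain (algebraMap S Kt)
  have : IsDiscreteValuationRing S := isDiscreteValuationRing_adicCompletion hinj
  obtain ⟨ϖ, hϖ⟩ := IsDiscreteValuationRing.exists_irreducible R
  have h : IsImmediate R S ϖ := isImmediate_adicCompletion hϖ
  -- `Ext` lives in `Type u`, so the fraction fields are replaced by models in the same universe.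
  let L := FractionRing S
  have : FaithfulSMul R L := (faithfulSMul_iff_algebraMap_injective R L).mpr <| by
    rw [IsScalarTower.algebraMap_eq R S L]
    exact (IsFractionRing.injective S L).comp hinj
  let : Algebra (FractionRing R) L := FractionRing.liftAlgebra R L
  have : IsScalarTower R (FractionRing R) L := FractionRing.isScalarTower_liftAlgebra R L
  let eK : FractionRing R ≃ₐ[R] K := FractionRing.algEquiv R K
  let eL : L ≃ₐ[S] Kt := FractionRing.algEquiv S Kt
  have hKL : ¬ Module.Finite (FractionRing R) L := by
    intro hfin
    refine hK (Module.Finite.of_equiv_equiv eK.toRingEquiv eL.toRingEquiv ?_)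
    refine IsLocalization.ringHom_ext (nonZeroDivisors R) (RingHom.ext fun r ↦ ?_)
    change algebraMap K Kt (eK (algebraMap R _ r)) = eL (algebraMap _ L (algebraMap R _ r))
    rw [eK.commutes, ← IsScalarTower.algebraMap_apply, ← IsScalarTower.algebraMap_apply,
      IsScalarTower.algebraMap_apply R S L, eL.commutes, ← IsScalarTower.algebraMap_apply]
  obtain ⟨hsub, C, hC, ⟨e⟩⟩ := h.exists_ext_one_linearEquiv (FractionRing R) L hKL
  obtain ⟨eE⟩ := hE.nonempty_linearEquiv (h.isInjectiveHull (L := L))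
  let : Module S E := eE.toAddEquiv.module S
  have hsmul (s : S) (x : E) : eE (s • x) = s • eE x := eE.apply_symm_apply _
  let eE' : E ≃ₗ[S] FracQuot S L := { eE with map_smul' := hsmul }
  refine ⟨hsub, inferInstance, ?_, (FracQuot.isInjectiveHull S L).of_linearEquiv eE'.symm, C, hC,
    ⟨e ≪≫ₗ .prodCongr eE'.symm (Finsupp.mapRange.linearEquiv eL.toLinearEquiv)⟩⟩
  refine .of_algebraMap_smul fun r x ↦ eE.injective ?_
  rw [hsmul, algebraMap_smul, map_smul]
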